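/- Conventions. For words $w_1,\dots,w_n$ over a finite alphabet $A$, let $\mathrm{conv}(w_1,\dots,w_n)$ be the word of length $\max_i |w_i|$ over $(A\cup\{\$\})^n$ whose $j$-th letter is the $n$-tuple of the $j$-th letters of $w_1,\dots,w_n$, where the padding symbol $\$\notin A$ is used for a word that has no $j$-th letter. A relation $R\subseteq (A^*)^n$ is regular if the language $\mathrm{conv}(R)$ is regular. An algebra is a set $S$ with finitely many finitary operations $f_1,\dots,f_m$, where $f_j$ has arity $k_j\ge 0$. An injective unary FA-presentation $(a^*,\phi)$ of $S$ is a bijection $\phi:a^*\to S$, where $a^*$ is the set of all words over the one-letter alphabet $\{a\}$, such that for each $j$ the relation $$\Lambda(f_j,\phi)=\{(w_1,\dots,w_{k_j},w)\in (a^*)^{k_j+1} : f_j(\phi(w_1),\dots,\phi(w_{k_j}))=\phi(w)\}$$ is regular. (The relation $\Lambda({=},\phi)=\{(w,w):w\in a^*\}$ is then regular too.) Theorem. Let $S$ be an algebra with an injective unary FA-presentation $(a^*,\phi)$, let $T$ be a finitely generated subalgebra of $S$, and let $L=\{w\in a^* : \phi(w)\in T\}$ be the language of representatives of elements of $T$.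 Then $L$ is regular. Moreover, a finite automaton recognizing $L$ can be constructed effectively, uniformly in the presentation: there is a single algorithm which, given any finite list of the arities $k_j$ together with finite automata recognizing $\mathrm{conv}(\Lambda(f_j,\phi))$, one for each operation of an algebra $S$ with an injective unary FA-presentation $(a^*,\phi)$, and given any finite list $X$ of words in $a^*$, halts and outputs a finite automaton that recognizes the language of representatives of elements of the subalgebra of $S$ generated by $\phi(X)$. -/

import Mathlib

universe u v w

namespace FAPres

/-! ## Regular relations -/

/-- The convolution of an `n`-tuple of words: the word of `n`-tuples whose `j`-th letter consists
of the `j`-th letters of the components. The padding symbol `$` is `none`, the letter `x` is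
`some x`. -/
def conv {A : Type u} {n : ℕ} (x : Fin n → List A) : List (Fin n → Option A) :=
  (List.range (Finset.univ.sup fun i => (x i).length)).map fun j i => (x i)[j]?

/-- The language `conv R`. -/
def convLanguage {A : Type u} {n : ℕ} (R : Set (Fin n → List A)) : Language (Fin n → Option A) :=
  {y | ∃ x ∈ R, conv x = y}

/-- A relation on words is regular if its convolution is a regular language. -/
def IsRegularRel {A : Type u} {n : ℕ} (R : Set (Fin n → List A)) : Prop :=
  (convLanguage R).IsRegular

/-! ## FA-presentations -/

/-- `Λ(R, φ)`: the tuples of words of `L` whose images under `φ` are related by `R`. -/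
def pullback {A : Type u} {S : Type v} (L : Language A) (φ : List A → S) {n : ℕ}
    (R : Set (Fin n → S)) : Set (Fin n → List A) :=
  {x | (∀ i, x i ∈ L) ∧ (fun i => φ (x i)) ∈ R}

/-- The graph of a `k`-ary operation, as a `(k + 1)`-ary relation (the value comes last). -/
def graph {S : Type v} {k : ℕ} (f : (Fin k → S) → S) : Set (Fin (k + 1) → S) :=
  {s | f (fun i => s i.castSucc) = s (Fin.last k)}

/-- `(L, φ)` is an FA-presentation of the structure `S`, over the finite alphabet `A`. Only the
values of `φ` on `L` matter; a `k`-ary operation is viewed as a `(k + 1)`-ary relation. -/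
structure IsFAPresentation (σ : FirstOrder.Language.{u, v}) {S : Type w} [σ.Structure S]
    {A : Type} [Finite A] (L : Language A) (φ : List A → S) : Prop where
  regular : L.IsRegular
  surjective : ∀ s : S, ∃ x ∈ L, φ x = s
  eq_regular : IsRegularRel (pullback L φ {s : Fin 2 → S | s 0 = s 1})
  fun_regular : ∀ (k : ℕ) (f : σ.Functions k),
    IsRegularRel (pullback L φ (graph (FirstOrder.Language.Structure.funMap (M := S) f)))
  rel_regular : ∀ (k : ℕ) (r : σ.Relations k),
    IsRegularRel (pullback L φ {s : Fin k → S | FirstOrder.Language.Structure.RelMap r s})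

/-- `(a^*, φ)` is an injective unary FA-presentation of `S`. The one-letter alphabet is `Unit`,
so that `a^*` is the language `⊤` of all words over `Unit`. -/
def IsInjectiveUnaryFAPresentation (σ : FirstOrder.Language.{u, v}) {S : Type w} [σ.Structure S]
    (φ : List Unit → S) : Prop :=
  IsFAPresentation σ (⊤ : Language Unit) φ ∧ Function.Injective φ

/-- The language of those words that represent an element of the subset `T`. -/
def representatives {A : Type u} {S : Type v} (φ : List A → S) (T : Set S) : Language A :=
  {x | φ x ∈ T}

/-! ## Finite automata and presentations as data -/

/-- A finite automaton as a finite object: the list of the initial states, the list of the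
transitions `(p, x, q)` (from `p` to `q`, reading `x`), and the list of the accepting states. -/
abbrev FACode (α : Type) : Type := List ℕ × List (ℕ × α × ℕ) × List ℕ

/-- The automaton that is described by a code. Only the finitely many states that occur in the
code are ever visited. -/
def FACode.toNFA {α : Type} (c : FACode α) : NFA α ℕ where
  start := {q | q ∈ c.1}
  step p x := {q | (p, x, q) ∈ c.2.1}
  accept := {q | q ∈ c.2.2}

/-- The language that is recognized by a code. -/
def FACode.accepts {α : Type} (c : FACode α) : Language α := c.toNFA.accepts

/-- The code `c` is an automaton that recognizes `conv R`. The letters of a convolution, which are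
`n`-tuples, are written as lists of length `n`, so that all arities share one type of codes. -/
def FACode.RecognizesRel {A : Type} {n : ℕ} (c : FACode (List (Option A)))
    (R : Set (Fin n → List A)) : Prop :=
  c.accepts = {y | ∃ x ∈ R, y = (conv x).map List.ofFn}

/-- The finite data by which a presentation `(a^*, φ)` of an algebra is given to an algorithm: a
list that holds, for each operation, its arity and an automaton. -/
abbrev PresentationCode : Type := List (ℕ × FACode (List (Option Unit)))

/-- `P` describes the presentation `(a^*, φ)` of the algebra `S`: each entry of `P` consists of the
arity of some operation and of an automaton that recognizes the relation `Λ(f, φ)` of this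
operation, and each operation has an entry. -/
def PresentationCode.Describes (P : PresentationCode) (σ : FirstOrder.Language.{u, v})
    {S : Type w} [σ.Structure S] (φ : List Unit → S) : Prop :=
  (∀ e ∈ P, ∃ f : σ.Functions e.1, e.2.RecognizesRel
      (pullback ⊤ φ (graph (FirstOrder.Language.Structure.funMap (M := S) f)))) ∧
  (∀ (k : ℕ) (f : σ.Functions k), ∃ c : FACode (List (Option Unit)), (k, c) ∈ P ∧
    c.RecognizesRel
      (pullback ⊤ φ (graph (FirstOrder.Language.Structure.funMap (M := S) f))))

end FAPres

namespace FAPres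

/-! ## Eventually periodic sequences -/

/-! Over a one-letter alphabet a word is its length, so a subset of `S` is an infinite Boolean word
`Y`. The generated subalgebra is the least closed set containing the generators. Hence `x` lies
outside it iff some `Y` codes a closed set, carries `true` at the generators and `false` at the
length of `x`.

Closure is a safety condition: `Y` codes a closed set iff none of its prefixes lies in `nonClosed
P`, the words that already show arguments inside the set and a value outside. This language is
closed under extension. It has finitely many left quotients, because the automata for the operations
read a convolution in step with `Y`, so that a finite `profile` determines the future
(`append_mem_nonClosed_of_profile_subset`).

Two pigeonhole arguments finish the proof. A finite word that avoids `nonClosed P` far enough past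
the relevant positions can be looped into an infinite one (`exists_infinite_extension`), so a
bounded search decides non-membership (`omits_iff`). Past the generators, the set of quotients
reachable in `n` steps evolves by a fixed map on a finite power set, so the answer is eventually
periodic in `n` (`avoidable_add_factorial`). Threshold and period are computable from the input, and
a lasso automaton recognizes the resulting language. -/

theorem exists_lt_eq_of_ncard_le {β : Type*} {s : Set β} (hs : s.Finite) {K : ℕ}
    (hK : s.ncard ≤ K) (f : ℕ → β) (hf : ∀ n, f n ∈ s) (a : ℕ) :
    ∃ i j, a ≤ i ∧ i < j ∧ j ≤ a + K ∧ f i = f j := by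
  have h : s.ncard < ((Finset.Icc a (a + K) : Finset ℕ) : Set ℕ).ncard := by
    rw [Set.ncard_coe_finset, Nat.card_Icc]; omega
  obtain ⟨i, hi, j, hj, hne, he⟩ :=
    Set.exists_ne_map_eq_of_ncard_lt_of_maps_to h (f := f) (fun n _ => hf n) hs
  simp only [Finset.coe_Icc, Set.mem_Icc] at hi hj
  rcases lt_or_gt_of_ne hne with h | h
  · exact ⟨i, j, hi.1, h, hj.2, he⟩
  · exact ⟨j, i, hj.1, h, hi.2, he.symm⟩

/-- Once a value repeats, the recursion makes the sequence periodic. The gap between the repeats is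
unknown but at most `K`, so `K.factorial` is a period that depends on `K` alone. -/
theorem apply_add_factorial_of_recursive {β : Type*} {s : Set β} (hs : s.Finite) {K : ℕ}
    (hK : s.ncard ≤ K) (f : ℕ → β) (hf : ∀ n, f n ∈ s) {a : ℕ} (g : β → β)
    (hg : ∀ n, a ≤ n → f (n + 1) = g (f n)) {n : ℕ} (hn : a + K ≤ n) :
    f (n + K.factorial) = f n := by
  obtain ⟨i, j, hai, hij, hjK, he⟩ := exists_lt_eq_of_ncard_le hs hK f hf a
  have step : ∀ m, i ≤ m → f (m + (j - i)) = f m := by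
    intro m hm
    induction m, hm using Nat.le_induction with
    | base => rw [he]; congr 1; omega
    | succ m hm ih =>
      rw [show m + 1 + (j - i) = m + (j - i) + 1 by omega, hg _ (by omega), ih, hg m (by omega)]
  have steps : ∀ k m, i ≤ m → f (m + (j - i) * k) = f m := by
    intro k
    induction k with
    | zero => simp
    | succ k ih => intro m hm; rw [Nat.mul_succ, ← add_assoc, step _ (by omega), ih m hm]
  obtain ⟨k, hk⟩ : j - i ∣ K.factorial := Nat.dvd_factorial (by omega) (by omega)
  rw [hk, steps k n (by omega)]

/-! ## Infinite words avoiding an open set -/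

/-- The prefix of length `n` of an infinite word. -/
def prefixWord {α : Type*} (Y : ℕ → α) (n : ℕ) : List α := (List.range n).map Y

theorem prefixWord_succ {α : Type*} (Y : ℕ → α) (n : ℕ) :
    prefixWord Y (n + 1) = prefixWord Y n ++ [Y n] := by
  simp [prefixWord, List.range_succ]

@[simp] theorem length_prefixWord {α : Type*} (Y : ℕ → α) (n : ℕ) :
    (prefixWord Y n).length = n := by simp [prefixWord]

theorem getElem?_prefixWord {α : Type*} (Y : ℕ → α) {n j : ℕ} (h : j < n) :
    (prefixWord Y n)[j]? = some (Y j) := by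
  simp [prefixWord, h]

theorem leftQuotient_append_congr {α : Type*} {B : Language α} {x y : List α}
    (h : B.leftQuotient x = B.leftQuotient y) (z : List α) :
    B.leftQuotient (x ++ z) = B.leftQuotient (y ++ z) := by
  rw [Language.leftQuotient_append, Language.leftQuotient_append, h]

theorem mem_iff_of_leftQuotient_eq {α : Type*} {B : Language α} {x y : List α}
    (h : B.leftQuotient x = B.leftQuotient y) : x ∈ B ↔ y ∈ B := by
  have := congrArg (fun L : Language α => [] ∈ L) h
  simpa [Language.mem_leftQuotient] using this

/-- Pumping: two prefixes of `y`, of lengths between `a` and `a + C`, have the same left quotient,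
and the segment between them is repeated forever. Each prefix of the result then has the quotient of
a prefix of `y`, and no prefix of `y` is in `B` because `B` is closed under extension. -/
theorem exists_infinite_extension {α : Type*} {B : Language α}
    (hB : ∀ x y, x ∈ B → x ++ y ∈ B) (hfin : (Set.range B.leftQuotient).Finite) {C : ℕ}
    (hC : (Set.range B.leftQuotient).ncard ≤ C) {y : List α} (hy : y ∉ B) {a : ℕ}
    (ha : a + C < y.length) :
    ∃ Y : ℕ → α, (∀ n, n < a → y[n]? = some (Y n)) ∧ ∀ n, prefixWord Y n ∉ B := by
  obtain ⟨i, j, hai, hij, hja, he⟩ := exists_lt_eq_of_ncard_le hfin hC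
    (fun n => B.leftQuotient (y.take n)) (fun n => ⟨_, rfl⟩) a
  have hpos : 0 < y.length := by omega
  -- Positions from `i` on are folded back into the loop `[i, j)`.
  let idx : ℕ → ℕ := fun n => if n < i then n else i + (n - i) % (j - i)
  have hidx : ∀ n, idx n < j := by
    intro n
    have := Nat.mod_lt (n - i) (show 0 < j - i by omega)
    simp only [idx]; split_ifs <;> omega
  have hlt : ∀ n, n < j → idx n = n := by
    intro n hn
    simp only [idx]; split_ifs with h
    · rfl
    · rw [Nat.mod_eq_of_lt (by omega)]; omega
  have hper : ∀ n, j ≤ n → idx n = idx (n - (j - i)) := by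
    intro n hn
    simp only [idx]
    rw [if_neg (by omega), if_neg (by omega), Nat.mod_eq_sub_mod (by omega)]
    congr 2; omega
  let Y : ℕ → α := fun n => y[idx n]'(by have := hidx n; omega)
  have hY : ∀ n, n < j → y[n]? = some (Y n) := by
    intro n hn
    simp only [Y, hlt n hn]
    exact List.getElem?_eq_getElem _
  have hYper : ∀ n, j ≤ n → Y n = Y (n - (j - i)) := by
    intro n hn
    simp only [Y, hper n hn]
  have hpre : ∀ n, n ≤ j → prefixWord Y n = y.take n := by
    intro n hn
    apply List.ext_getElem?
    intro m
    by_cases hm : m < n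
    · rw [getElem?_prefixWord Y hm, List.getElem?_take, if_pos hm, hY m (by omega)]
    · rw [List.getElem?_eq_none (by simpa using hm), List.getElem?_eq_none (by simp; omega)]
  have hquot : ∀ n, j ≤ n →
      B.leftQuotient (prefixWord Y n) = B.leftQuotient (prefixWord Y (n - (j - i))) := by
    intro n hn
    induction n, hn using Nat.le_induction with
    | base => rw [hpre j le_rfl, hpre _ (by omega), show j - (j - i) = i by omega]; exact he.symm
    | succ n hn ih =>
      rw [show n + 1 - (j - i) = n - (j - i) + 1 by omega, prefixWord_succ, prefixWord_succ,
        ← hYper n hn]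
      exact leftQuotient_append_congr ih _
  refine ⟨Y, fun n hn => hY n (by omega), fun n => ?_⟩
  induction n using Nat.strong_induction_on with
  | _ n ih =>
    rcases le_or_gt j n with h | h
    · rw [mem_iff_of_leftQuotient_eq (hquot n h)]
      exact ih _ (by omega)
    · rw [hpre n h.le]
      intro hmem
      exact hy (by simpa using hB _ (y.drop n) hmem)

/-! ## Periodicity of the set of positions that can be avoided -/

/-- The word `y` carries `true` at all positions of the list `X`, as far as it reaches. -/
def Marks (X : List ℕ) (y : List Bool) : Prop := ∀ x ∈ X, x < y.length → y[x]? = some true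

/-- Some marked word of length `n + 1 + K` outside of `B` carries `false` at position `n`. -/
def Avoidable (B : Language Bool) (X : List ℕ) (K n : ℕ) : Prop :=
  ∃ y : List Bool, y.length = n + 1 + K ∧ y ∉ B ∧ Marks X y ∧ y[n]? = some false

/-- The left quotients of `B` by the marked words of length `n`. -/
def markedQuotients (B : Language Bool) (X : List ℕ) (n : ℕ) : Set (Language Bool) :=
  {Q | ∃ y : List Bool, y.length = n ∧ Marks X y ∧ B.leftQuotient y = Q}

theorem marks_append_iff {X : List ℕ} {y z : List Bool} (h : ∀ x ∈ X, x < y.length) :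
    Marks X (y ++ z) ↔ Marks X y := by
  refine forall₂_congr fun x hx => ?_
  have hx' := h x hx
  simp [hx', Nat.lt_add_right]

/-- Past the last mark the next letter is free, so this is one step of a subset construction, by a
map that does not depend on `n`. -/
theorem markedQuotients_succ (B : Language Bool) {X : List ℕ} {n : ℕ} (h : ∀ x ∈ X, x < n) :
    markedQuotients B X (n + 1) =
      {Q | ∃ R ∈ markedQuotients B X n, ∃ b, R.leftQuotient [b] = Q} := by
  ext Q
  constructor
  · rintro ⟨y, hy, hm, rfl⟩
    obtain ⟨z, b, rfl⟩ : ∃ z b, y = z ++ [b] :=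
      ⟨y.dropLast, y.getLast (by rintro rfl; simp at hy), (List.dropLast_append_getLast _).symm⟩
    have hz : z.length = n := by simpa using hy
    exact ⟨_, ⟨z, hz, (marks_append_iff (by rwa [hz])).1 hm, rfl⟩, b,
      (Language.leftQuotient_append _ _ _).symm⟩
  · rintro ⟨_, ⟨z, hz, hm, rfl⟩, b, rfl⟩
    exact ⟨z ++ [b], by simp [hz], (marks_append_iff (by rwa [hz])).2 hm,
      Language.leftQuotient_append _ _ _⟩

theorem avoidable_iff_markedQuotients (B : Language Bool) {X : List ℕ} {K n : ℕ}
    (h : ∀ x ∈ X, x < n) :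
    Avoidable B X K n ↔
      ∃ Q ∈ markedQuotients B X n, ∃ z : List Bool, z.length = K ∧ false :: z ∉ Q := by
  constructor
  · rintro ⟨y, hl, hB, hm, hn⟩
    have hlen : (y.take n).length = n := by simp [hl]; omega
    have hdrop : y = y.take n ++ false :: y.drop (n + 1) := by
      have h1 : n < y.length := by omega
      have h2 : y[n] = false := by simpa [h1] using hn
      rw [← h2, List.getElem_cons_drop h1, List.take_append_drop]
    refine ⟨_, ⟨y.take n, hlen, ?_, rfl⟩, y.drop (n + 1), by simp [hl], ?_⟩
    · rw [hdrop] at hm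
      exact (marks_append_iff (by rwa [hlen])).1 hm
    · rwa [Language.mem_leftQuotient, ← hdrop]
  · rintro ⟨_, ⟨y, hl, hm, rfl⟩, z, hz, hB⟩
    exact ⟨y ++ false :: z, by simp [hl, hz]; omega, hB,
      (marks_append_iff (by rwa [hl])).2 hm, by simp [hl]⟩

/-- Beyond the marks, avoidability at `n` depends only on `markedQuotients B X n`. This is one of at
most `2 ^ C` sets of quotients, whatever the lookahead `K`. -/
theorem avoidable_add_factorial {B : Language Bool} (hfin : (Set.range B.leftQuotient).Finite)
    {C : ℕ} (hC : (Set.range B.leftQuotient).ncard ≤ C) {X : List ℕ} (K : ℕ) {a n : ℕ}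
    (hX : ∀ x ∈ X, x < a) (hn : a + 2 ^ C ≤ n) :
    Avoidable B X K (n + (2 ^ C).factorial) ↔ Avoidable B X K n := by
  have hcard : (𝒫 (Set.range B.leftQuotient)).ncard ≤ 2 ^ C := by
    rw [Set.ncard_powerset _ hfin]
    exact Nat.pow_le_pow_right (by norm_num) hC
  have key := apply_add_factorial_of_recursive hfin.powerset hcard (markedQuotients B X)
    (by rintro n _ ⟨y, -, -, rfl⟩; exact ⟨y, rfl⟩)
    (fun E => {Q | ∃ R ∈ E, ∃ b, R.leftQuotient [b] = Q})
    (fun n (hn : a ≤ n) => markedQuotients_succ B fun x hx => (hX x hx).trans_le hn) hn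
  rw [avoidable_iff_markedQuotients B fun x hx => by have := hX x hx; omega, key,
    ← avoidable_iff_markedQuotients B fun x hx => by have := hX x hx; omega]

/-! ## Convolutions of tuples of unary words -/

/-- The convolution of the words `a ^ ns i`, with letters written as lists. -/
def tupleConv {n : ℕ} (ns : Fin n → ℕ) : List (List (Option Unit)) :=
  (conv fun i => List.replicate (ns i) ()).map List.ofFn

theorem getElem?_tupleConv {n : ℕ} (ns : Fin n → ℕ) (j : ℕ) :
    (tupleConv ns)[j]? = if ∃ i, j < ns i then
      some (List.ofFn fun i => if j < ns i then some () else none) else none := by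
  have h : (j < Finset.univ.sup ns) ↔ ∃ i, j < ns i := by simp [Finset.lt_sup_iff]
  simp only [tupleConv, conv, List.length_replicate, List.getElem?_map]
  split_ifs with hj
  · rw [List.getElem?_range (h.2 hj)]
    simp only [Option.map_some, Option.some.injEq]
    congr 1; funext i
    simp [List.getElem?_replicate]
  · rw [List.getElem?_eq_none (by simpa using fun hlt => hj (h.1 hlt))]
    rfl

theorem tupleConv_take_eq {n : ℕ} {ns ms : Fin n → ℕ} {a : ℕ}
    (h : ∀ j, j < a → ∀ i, j < ns i ↔ j < ms i) :
    (tupleConv ns).take a = (tupleConv ms).take a := by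
  apply List.ext_getElem?
  intro j
  rw [List.getElem?_take, List.getElem?_take]
  split_ifs with hj
  · simp only [getElem?_tupleConv, h j hj]
  · rfl

theorem tupleConv_drop_eq {n : ℕ} {ns ms : Fin n → ℕ} {a b : ℕ}
    (h : ∀ j i, a + j < ns i ↔ b + j < ms i) :
    (tupleConv ns).drop a = (tupleConv ms).drop b := by
  apply List.ext_getElem?
  intro j
  simp only [List.getElem?_drop, getElem?_tupleConv, h]

/-! ## Witnesses of non-closure -/

/-- The label that a component of a tuple of the graph of an operation carries in a witness of
non-closure: arguments belong to the set, the value does not. -/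
def label {k : ℕ} (i : Fin (k + 1)) : Bool := decide (i ≠ Fin.last k)

/-- The words that are not a prefix of the characteristic sequence of a set closed under the
relations of `P`, because a tuple below their length violates closure. -/
def nonClosed (P : PresentationCode) : Language Bool :=
  {y | ∃ e ∈ P, ∃ ns : Fin (e.1 + 1) → ℕ, (∀ i, y[ns i]? = some (label i)) ∧
    tupleConv ns ∈ e.2.accepts}

theorem append_mem_nonClosed {P : PresentationCode} {x : List Bool} (y : List Bool)
    (hx : x ∈ nonClosed P) : x ++ y ∈ nonClosed P := by
  obtain ⟨e, he, ns, hns, hacc⟩ := hx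
  refine ⟨e, he, ns, fun i => ?_, hacc⟩
  rw [List.getElem?_append_left, hns i]
  exact (List.getElem?_eq_some_iff.1 (hns i)).1

/-- What the automata of `P` can know after reading `y`: the entry, the set of components of the
tuple that have ended, and the state. -/
def profile (P : PresentationCode) (y : List Bool) :
    Set ((ℕ × FACode (List (Option Unit))) × List Bool × ℕ) :=
  {x | x.1 ∈ P ∧ ∃ ns : Fin (x.1.1 + 1) → ℕ,
    (∀ i, ns i < y.length → y[ns i]? = some (label i)) ∧
    (List.ofFn fun i => decide (ns i < y.length)) = x.2.1 ∧
    x.2.2 ∈ x.1.2.toNFA.evalFrom x.1.2.toNFA.start ((tupleConv ns).take y.length)}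

/-- A violating tuple is transplanted from `y ++ z` to `y' ++ z`. Components inside `y` are replaced
by those of a tuple with the same profile entry over `y'`, and components inside `z` are shifted.
The automaton enters the unchanged rest of the convolution in the same state. -/
theorem append_mem_nonClosed_of_profile_subset {P : PresentationCode} {y y' z : List Bool}
    (h : profile P y ⊆ profile P y') (hz : y ++ z ∈ nonClosed P) : y' ++ z ∈ nonClosed P := by
  obtain ⟨e, he, ns, hns, hacc⟩ := hz
  change tupleConv ns ∈ e.2.toNFA.acceptsFrom e.2.toNFA.start at hacc
  rw [← List.take_append_drop y.length (tupleConv ns), NFA.append_mem_acceptsFrom,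
    NFA.mem_acceptsFrom] at hacc
  obtain ⟨s, hs, hse⟩ := hacc
  obtain ⟨q, hq, hqs⟩ := NFA.mem_evalFrom_iff_exists.1 hse
  obtain ⟨-, ms, hms, hpat, hqm⟩ := @h (e, List.ofFn fun i => decide (ns i < y.length), q)
    ⟨he, ns, fun i hi => by rw [← hns i, List.getElem?_append_left hi], rfl, hq⟩
  have hpat' : ∀ i, ms i < y'.length ↔ ns i < y.length := by
    intro i
    have := congrFun (List.ofFn_injective hpat) i
    simpa using this
  let ls : Fin (e.1 + 1) → ℕ := fun i =>
    if ns i < y.length then ms i else ns i - y.length + y'.length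
  have htake : (tupleConv ls).take y'.length = (tupleConv ms).take y'.length := by
    refine tupleConv_take_eq fun j hj i => ?_
    have := hpat' i
    simp only [ls]; split_ifs <;> omega
  have hdrop : (tupleConv ls).drop y'.length = (tupleConv ns).drop y.length := by
    refine tupleConv_drop_eq fun j i => ?_
    have := hpat' i
    simp only [ls]; split_ifs <;> omega
  refine ⟨e, he, ls, fun i => ?_, ?_⟩
  · have h1 := hpat' i
    have h2 := hns i
    simp only [ls]; split_ifs with hi
    · rw [List.getElem?_append_left (h1.2 hi), hms i (h1.2 hi)]
    · rw [List.getElem?_append_right (by omega)] at h2 ⊢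
      simpa using h2
  · change tupleConv ls ∈ e.2.toNFA.acceptsFrom e.2.toNFA.start
    rw [← List.take_append_drop y'.length (tupleConv ls), NFA.append_mem_acceptsFrom,
      NFA.mem_acceptsFrom, htake, hdrop]
    exact ⟨s, hs, NFA.mem_evalFrom_iff_exists.2 ⟨q, hqm, hqs⟩⟩

/-! ## The number of left quotients -/

/-- All words of length `n` over the letters in `l`. -/
def words {α : Type*} (l : List α) (n : ℕ) : List (List α) :=
  n.rec [[]] fun _ ws => ws.flatMap fun w => l.map fun a => a :: w

theorem mem_words {α : Type*} {l : List α} {n : ℕ} {w : List α} :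
    w ∈ words l n ↔ w.length = n ∧ ∀ a ∈ w, a ∈ l := by
  induction n generalizing w with
  | zero => simp [words]; rintro rfl; simp
  | succ n ih =>
    have : words l (n + 1) = (words l n).flatMap fun w => l.map fun a => a :: w := rfl
    rw [this]
    cases w with
    | nil => simp
    | cons b w => simp [ih]; tauto

/-- The states that occur in a code as initial states or as targets of transitions. -/
def FACode.reached {α : Type} (c : FACode α) : List ℕ := c.1 ++ c.2.1.map fun t => t.2.2

theorem FACode.mem_reached_of_mem_evalFrom {α : Type} (c : FACode α) (w : List α) {q : ℕ}
    (h : q ∈ c.toNFA.evalFrom c.toNFA.start w) : q ∈ c.reached := by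
  rcases List.eq_nil_or_concat w with rfl | ⟨w, a, rfl⟩
  · exact List.mem_append_left _ h
  · rw [List.concat_eq_append, NFA.evalFrom_append, NFA.evalFrom_singleton, NFA.mem_stepSet] at h
    obtain ⟨p, -, hp⟩ := h
    exact List.mem_append_right _ (List.mem_map.2 ⟨(p, a, q), hp, rfl⟩)

/-- A list of all possible members of a profile. -/
def configs (P : PresentationCode) : List ((ℕ × FACode (List (Option Unit))) × List Bool × ℕ) :=
  P.flatMap fun e => (words [true, false] (e.1 + 1)).flatMap fun D =>
    e.2.reached.map fun q => (e, D, q)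

theorem profile_subset_configs (P : PresentationCode) (y : List Bool) :
    profile P y ⊆ {x | x ∈ configs P} := by
  rintro ⟨e, D, q⟩ ⟨he, ns, -, hD, hq⟩
  simp only at he hD hq
  simp only [configs, Set.mem_ofPred_eq, List.mem_flatMap, List.mem_map]
  exact ⟨e, he, D, mem_words.2 ⟨by simp [← hD], by simp⟩, q,
    e.2.mem_reached_of_mem_evalFrom _ hq, rfl⟩

theorem leftQuotient_eq_of_profile_eq {P : PresentationCode} {y y' : List Bool}
    (h : profile P y = profile P y') :
    (nonClosed P).leftQuotient y = (nonClosed P).leftQuotient y' := by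
  ext z
  exact ⟨append_mem_nonClosed_of_profile_subset h.subset,
    append_mem_nonClosed_of_profile_subset h.symm.subset⟩

theorem range_leftQuotient_nonClosed (P : PresentationCode) :
    ∃ F : _ → Language Bool,
      Set.range (nonClosed P).leftQuotient ⊆ F '' 𝒫 {x | x ∈ configs P} := by
  -- The value `0` is taken only at sets that are not profiles, and is irrelevant.
  refine ⟨fun s => Function.extend (profile P) (nonClosed P).leftQuotient (fun _ => 0) s, ?_⟩
  rintro _ ⟨y, rfl⟩
  refine ⟨profile P y, profile_subset_configs P y, ?_⟩
  exact Function.FactorsThrough.extend_apply (fun _ _ h => leftQuotient_eq_of_profile_eq h) _ _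

theorem finite_range_leftQuotient_nonClosed (P : PresentationCode) :
    (Set.range (nonClosed P).leftQuotient).Finite := by
  obtain ⟨F, hF⟩ := range_leftQuotient_nonClosed P
  exact (((configs P).finite_toSet.powerset).image F).subset hF

/-- Finiteness alone gives regularity; an explicit bound computable from `P` makes the construction
effective. -/
theorem ncard_range_leftQuotient_nonClosed_le (P : PresentationCode) :
    (Set.range (nonClosed P).leftQuotient).ncard ≤ 2 ^ (configs P).length := by
  classical
  obtain ⟨F, hF⟩ := range_leftQuotient_nonClosed P
  have hfin := (configs P).finite_toSet
  calc _ ≤ (F '' 𝒫 {x | x ∈ configs P}).ncard :=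
        Set.ncard_le_ncard hF (hfin.powerset.image F)
    _ ≤ (𝒫 {x | x ∈ configs P}).ncard := Set.ncard_image_le hfin.powerset
    _ = 2 ^ {x | x ∈ configs P}.ncard := Set.ncard_powerset _ hfin
    _ ≤ 2 ^ (configs P).length := by
        refine Nat.pow_le_pow_right (by norm_num) ?_
        rw [← List.coe_toFinset, Set.ncard_coe_finset]
        exact List.toFinset_card_le _

/-! ## Primitive recursive predicates -/

section Primrec

variable {α β γ : Type*} [Primcodable α] [Primcodable β] [Primcodable γ]

theorem primrecPred_exists_mem {f : α → List β} {R : α → β → Prop} (hf : Primrec f)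
    (hR : PrimrecRel R) : PrimrecPred fun a => ∃ b ∈ f a, R a b :=
  (PrimrecRel.exists_mem_list hR.swap).comp hf .id

theorem primrecPred_forall_mem {f : α → List β} {R : α → β → Prop} (hf : Primrec f)
    (hR : PrimrecRel R) : PrimrecPred fun a => ∀ b ∈ f a, R a b :=
  (PrimrecRel.forall_mem_list hR.swap).comp hf .id

theorem primrecPred_mem {f : α → List β} {g : α → β} (hf : Primrec f) (hg : Primrec g) :
    PrimrecPred fun a => g a ∈ f a :=
  (primrecPred_exists_mem hf (R := fun a b => b = g a)
    (Primrec.eq.comp Primrec.snd (hg.comp Primrec.fst))).of_eq fun a => by simp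

theorem primrec_words : Primrec₂ (words : List β → ℕ → List (List β)) :=
  Primrec.nat_rec (.const [[]]) (Primrec.list_flatMap (Primrec.snd.comp Primrec.snd)
    (Primrec.list_map (Primrec.fst.comp Primrec.fst)
      (Primrec.list_cons.comp Primrec.snd (Primrec.snd.comp Primrec.fst)).to₂).to₂).to₂

theorem primrec_factorial : Primrec Nat.factorial :=
  (Primrec.nat_rec₁ 1 (f := fun n x => (n + 1) * x)
    (Primrec.nat_mul.comp (Primrec.succ.comp Primrec.fst) Primrec.snd)).of_eq fun n => by
      induction n with
      | zero => rfl
      | succ n ih => simp only [Nat.factorial_succ, ← ih]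

theorem primrec_two_pow : Primrec fun n : ℕ => 2 ^ n :=
  (Primrec₂.unpaired'.1 Nat.Primrec.pow).comp (.const 2) .id

end Primrec

/-! ## Deciding acceptance -/

/-- The list of the states that a code reaches on a word. -/
def FACode.reach {α : Type} [DecidableEq α] (c : FACode α) (w : List α) : List ℕ :=
  w.foldl (fun S x => c.2.1.filterMap fun t =>
    if t.1 ∈ S ∧ t.2.1 = x then some t.2.2 else none) c.1

theorem FACode.mem_accepts_iff_reach {α : Type} [DecidableEq α] (c : FACode α) (w : List α) :
    w ∈ c.accepts ↔ ∃ q ∈ c.2.2, q ∈ c.reach w := by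
  have key : ∀ S : List ℕ, {q | q ∈ w.foldl (fun S x => c.2.1.filterMap fun t =>
      if t.1 ∈ S ∧ t.2.1 = x then some t.2.2 else none) S} =
      c.toNFA.evalFrom {q | q ∈ S} w := by
    induction w with
    | nil => intro S; rfl
    | cons a w ih =>
      intro S
      rw [List.foldl_cons, ih, NFA.evalFrom_cons]
      congr 1
      ext q
      rw [NFA.mem_stepSet]
      simp only [Set.mem_ofPred_eq, List.mem_filterMap, FACode.toNFA]
      constructor
      · rintro ⟨⟨p, x, r⟩, ht, h⟩
        split_ifs at h with hp
        obtain ⟨hp, rfl⟩ := hp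
        obtain rfl := Option.some.inj h
        exact ⟨p, hp, ht⟩
      · rintro ⟨p, hp, ht⟩
        exact ⟨(p, a, q), ht, by simp [hp]⟩
  have h : ∀ q, q ∈ c.reach w ↔ q ∈ c.toNFA.evalFrom c.toNFA.start w :=
    fun q => Set.ext_iff.1 (key c.1) q
  simp only [h]
  rfl

theorem primrec_reach {α : Type} [Primcodable α] [DecidableEq α] :
    Primrec₂ (FACode.reach : FACode α → List α → List ℕ) := by
  refine Primrec.list_foldl (α := FACode α × List α) (h := fun a p => a.1.2.1.filterMap fun t =>
    if t.1 ∈ p.1 ∧ t.2.1 = p.2 then some t.2.2 else none) Primrec.snd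
    (Primrec.fst.comp Primrec.fst) ?_
  refine Primrec.listFilterMap (α := (FACode α × List α) × List ℕ × α)
    (Primrec.fst.comp (Primrec.snd.comp (Primrec.fst.comp Primrec.fst))) ?_
  refine Primrec.ite (PrimrecPred.and ?_ ?_)
    (Primrec.option_some.comp (Primrec.snd.comp (Primrec.snd.comp Primrec.snd))) (.const none)
  · exact primrecPred_mem (Primrec.fst.comp (Primrec.snd.comp Primrec.fst))
      (Primrec.fst.comp Primrec.snd)
  · exact Primrec.eq.comp (Primrec.fst.comp (Primrec.snd.comp Primrec.snd))
      (Primrec.snd.comp (Primrec.snd.comp Primrec.fst))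

theorem primrecRel_mem_accepts {α : Type} [Primcodable α] [DecidableEq α] :
    PrimrecRel fun (c : FACode α) (w : List α) => w ∈ c.accepts :=
  (primrecPred_exists_mem (Primrec.snd.comp (Primrec.snd.comp Primrec.fst))
    (primrecPred_mem (primrec_reach.comp (Primrec.fst.comp Primrec.fst)
      (Primrec.snd.comp Primrec.fst)) Primrec.snd).primrecRel).of_eq
    fun p => (FACode.mem_accepts_iff_reach p.1 p.2).symm

/-! ## Deciding avoidability -/

/-- The convolution of a list of unary words that are given by their lengths. -/
def listConv (l : List ℕ) : List (List (Option Unit)) :=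
  (List.range (l.foldr max 0)).map fun j => l.map fun n => if j < n then some () else none

theorem lt_foldr_max_iff {l : List ℕ} {j : ℕ} : j < l.foldr max 0 ↔ ∃ n ∈ l, j < n := by
  induction l with
  | nil => simp
  | cons a l ih => simp [ih]

theorem listConv_ofFn {n : ℕ} (ns : Fin n → ℕ) : listConv (List.ofFn ns) = tupleConv ns := by
  apply List.ext_getElem?
  intro j
  have h : j < (List.ofFn ns).foldr max 0 ↔ ∃ i, j < ns i := by
    simp [lt_foldr_max_iff, List.mem_ofFn]
  rw [getElem?_tupleConv, listConv, List.getElem?_map]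
  split_ifs with hj
  · rw [List.getElem?_range (h.2 hj)]
    simp [List.map_ofFn, Function.comp_def]
  · rw [List.getElem?_eq_none (by simpa using fun hlt => hj (h.1 hlt))]
    rfl

theorem primrec_listConv : Primrec listConv := by
  refine Primrec.list_map (Primrec.list_range.comp (Primrec.list_foldr .id (.const 0)
    (Primrec.nat_max.comp (Primrec.fst.comp Primrec.snd) (Primrec.snd.comp Primrec.snd)).to₂)) ?_
  exact Primrec.list_map Primrec.fst (Primrec.ite
    (Primrec.nat_lt.comp (Primrec.snd.comp Primrec.fst) Primrec.snd)
    (.const (some ())) (.const none))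

/-- Every component of a violating tuple is a position of `y`, so the search for one is bounded. -/
theorem mem_nonClosed_iff (P : PresentationCode) (y : List Bool) :
    y ∈ nonClosed P ↔ ∃ e ∈ P, ∃ l ∈ words (List.range y.length) e.1,
      ∃ m ∈ List.range y.length, ((∀ n ∈ l, y[n]? = some true) ∧ y[m]? = some false) ∧
        listConv (l ++ [m]) ∈ e.2.accepts := by
  refine exists_congr fun e => and_congr_right fun _ => ?_
  have hlt : ∀ {n b}, y[n]? = some b → n < y.length :=
    fun h => (List.getElem?_eq_some_iff.1 h).1
  constructor
  · rintro ⟨ns, hns, hacc⟩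
    refine ⟨List.ofFn fun i => ns i.castSucc, mem_words.2 ⟨by simp, fun a ha => ?_⟩,
      ns (Fin.last _), by simpa using hlt (hns _), ⟨fun n hn => ?_, by simp [hns, label]⟩, ?_⟩
    · obtain ⟨i, rfl⟩ := (List.mem_ofFn' _ _).1 ha
      simpa using hlt (hns _)
    · obtain ⟨i, rfl⟩ := (List.mem_ofFn' _ _).1 hn
      simp [hns, label, (Fin.castSucc_lt_last i).ne]
    · rwa [← List.concat_eq_append, ← List.ofFn_succ' , listConv_ofFn]
  · rintro ⟨l, hl, m, -, ⟨hargs, hm⟩, hacc⟩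
    obtain ⟨k, c⟩ := e
    obtain ⟨rfl, -⟩ := mem_words.1 hl
    refine ⟨Fin.snoc (α := fun _ => ℕ) l.get m, fun i => ?_, ?_⟩
    · refine Fin.lastCases ?_ (fun i => ?_) i
      · simpa [label] using hm
      · simpa [label, (Fin.castSucc_lt_last i).ne] using hargs _ (l.get_mem i)
    · rw [← listConv_ofFn, List.ofFn_succ', List.concat_eq_append]
      simpa using hacc

theorem primrecRel_mem_nonClosed :
    PrimrecRel fun (P : PresentationCode) (y : List Bool) => y ∈ nonClosed P := by
  have hlen : Primrec fun p : PresentationCode × List Bool => List.range p.2.length :=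
    Primrec.list_range.comp (Primrec.list_length.comp Primrec.snd)
  refine PrimrecPred.of_eq ?_ fun p => (mem_nonClosed_iff p.1 p.2).symm
  refine primrecPred_exists_mem Primrec.fst ?_
  refine primrecPred_exists_mem (primrec_words.comp (hlen.comp Primrec.fst)
    (Primrec.fst.comp Primrec.snd)) ?_
  refine primrecPred_exists_mem (hlen.comp (Primrec.fst.comp Primrec.fst)) ?_
  have hy : Primrec fun p : (((PresentationCode × List Bool) ×
      (ℕ × FACode (List (Option Unit)))) × List ℕ) × ℕ => p.1.1.1.2 :=
    Primrec.snd.comp (Primrec.fst.comp (Primrec.fst.comp Primrec.fst))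
  refine PrimrecPred.and (PrimrecPred.and ?_ ?_) ?_
  · exact primrecPred_forall_mem (Primrec.snd.comp Primrec.fst) (Primrec.eq.comp
      (Primrec.list_getElem?.comp (hy.comp Primrec.fst) Primrec.snd) (.const (some true)))
  · exact Primrec.eq.comp (Primrec.list_getElem?.comp hy Primrec.snd) (.const (some false))
  · exact primrecRel_mem_accepts.comp
      (Primrec.snd.comp (Primrec.snd.comp (Primrec.fst.comp Primrec.fst)))
      (primrec_listConv.comp (Primrec.list_concat.comp (Primrec.snd.comp Primrec.fst) Primrec.snd))

theorem primrecRel_marks : PrimrecRel Marks := by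
  have h : PrimrecRel fun (p : List ℕ × List Bool) (x : ℕ) =>
      ¬ x < p.2.length ∨ p.2[x]? = some true :=
    PrimrecPred.or (PrimrecPred.not (Primrec.nat_lt.comp Primrec.snd
      (Primrec.list_length.comp (Primrec.snd.comp Primrec.fst))))
      (Primrec.eq.comp (Primrec.list_getElem?.comp (Primrec.snd.comp Primrec.fst) Primrec.snd)
        (.const (some true)))
  exact (primrecPred_forall_mem Primrec.fst h).of_eq fun p => by
    simp only [Marks, imp_iff_not_or]

/-- The tuple of arguments is `((P, X), K, n)`. -/
theorem primrecPred_avoidable :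
    PrimrecPred fun p : (PresentationCode × List ℕ) × ℕ × ℕ =>
      Avoidable (nonClosed p.1.1) p.1.2 p.2.1 p.2.2 := by
  have h : PrimrecPred fun p : (PresentationCode × List ℕ) × ℕ × ℕ =>
      ∃ y ∈ words [true, false] (p.2.2 + 1 + p.2.1),
        y ∉ nonClosed p.1.1 ∧ Marks p.1.2 y ∧ y[p.2.2]? = some false := by
    refine primrecPred_exists_mem (primrec_words.comp (.const _) (Primrec.nat_add.comp
      (Primrec.succ.comp (Primrec.snd.comp Primrec.snd)) (Primrec.fst.comp Primrec.snd))) ?_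
    refine PrimrecPred.and (PrimrecPred.not ?_) (PrimrecPred.and ?_ ?_)
    · exact primrecRel_mem_nonClosed.comp (Primrec.fst.comp (Primrec.fst.comp Primrec.fst))
        Primrec.snd
    · exact primrecRel_marks.comp (Primrec.snd.comp (Primrec.fst.comp Primrec.fst)) Primrec.snd
    · exact Primrec.eq.comp (Primrec.list_getElem?.comp Primrec.snd
        (Primrec.snd.comp (Primrec.snd.comp Primrec.fst))) (.const (some false))
  exact h.of_eq fun p => by simp [Avoidable, mem_words]

theorem primrec_configs : Primrec configs := by
  refine Primrec.list_flatMap .id ?_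
  refine Primrec.list_flatMap (primrec_words.comp (.const _)
    (Primrec.succ.comp (Primrec.fst.comp Primrec.snd))) ?_
  have hc : Primrec fun p : (PresentationCode × (ℕ × FACode (List (Option Unit)))) × List Bool =>
      p.1.2.2 := Primrec.snd.comp (Primrec.snd.comp Primrec.fst)
  refine Primrec.list_map (Primrec.list_append.comp (Primrec.fst.comp hc)
    (Primrec.list_map (Primrec.fst.comp (Primrec.snd.comp hc))
      (Primrec.snd.comp (Primrec.snd.comp Primrec.snd)))) ?_
  exact Primrec.pair (Primrec.snd.comp (Primrec.fst.comp Primrec.fst))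
    (Primrec.pair (Primrec.snd.comp Primrec.fst) Primrec.snd)

/-! ## Automata for eventually periodic unary languages -/

/-- The successor of `i` in a path of length `t` followed by a cycle of length `p`. -/
def lassoNext (t p i : ℕ) : ℕ := if i + 1 = t + p then t else i + 1

/-- A path of length `t` followed by a cycle of length `p`, with the accepting states `F`. -/
def lasso (t p : ℕ) (F : List ℕ) : FACode Unit :=
  ([0], (List.range (t + p)).map fun i => (i, (), lassoNext t p i), F)

theorem lassoNext_lt {t p i : ℕ} (hp : 0 < p) (hi : i < t + p) : lassoNext t p i < t + p := by
  rw [lassoNext]; split_ifs <;> omega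

/-- The lasso state after `n` steps is a representative of `n` with the same future under `A`. -/
theorem exists_iterate_lassoNext {t p : ℕ} (hp : 0 < p) {A : ℕ → Prop}
    (hA : ∀ n, t ≤ n → (A (n + p) ↔ A n)) (n : ℕ) :
    (lassoNext t p)^[n] 0 < t + p ∧ ∀ j, A (n + j) ↔ A ((lassoNext t p)^[n] 0 + j) := by
  induction n with
  | zero => simp; omega
  | succ n ih =>
    obtain ⟨h1, h2⟩ := ih
    rw [Function.iterate_succ_apply']
    refine ⟨lassoNext_lt hp h1, fun j => ?_⟩
    rw [add_assoc, add_comm 1, h2, lassoNext]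
    split_ifs with h
    · rw [← hA (t + j) (by omega)]
      exact iff_of_eq (congrArg A (by omega))
    · exact iff_of_eq (congrArg A (by omega))

theorem evalFrom_lasso {t p : ℕ} (hp : 0 < p) (F : List ℕ) (w : List Unit) {i : ℕ}
    (hi : i < t + p) :
    (lasso t p F).toNFA.evalFrom {i} w = {(lassoNext t p)^[w.length] i} := by
  induction w generalizing i with
  | nil => rfl
  | cons a w ih =>
    have hstep : (lasso t p F).toNFA.step i a = {lassoNext t p i} := by
      ext q
      simp [lasso, FACode.toNFA, hi, eq_comm]
    rw [NFA.evalFrom_cons, NFA.stepSet_singleton, hstep, ih (lassoNext_lt hp hi)]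
    rfl

theorem mem_accepts_lasso {t p : ℕ} (hp : 0 < p) {A : ℕ → Prop}
    (hA : ∀ n, t ≤ n → (A (n + p) ↔ A n)) {F : List ℕ} (hF : ∀ i, i < t + p → (i ∈ F ↔ A i))
    (w : List Unit) : w ∈ (lasso t p F).accepts ↔ A w.length := by
  have hstart : (lasso t p F).toNFA.start = {0} := by ext; simp [lasso, FACode.toNFA]
  obtain ⟨h1, h2⟩ := exists_iterate_lassoNext hp hA w.length
  change (∃ q ∈ (lasso t p F).toNFA.accept, q ∈ (lasso t p F).toNFA.evalFrom _ w) ↔ _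
  rw [hstart, evalFrom_lasso hp F w (by omega)]
  simp only [Set.mem_singleton_iff, exists_eq_right]
  exact (hF _ h1).trans (h2 0).symm

theorem isRegular_of_eventually_periodic {t p : ℕ} (hp : 0 < p) {A : ℕ → Prop}
    (hA : ∀ n, t ≤ n → (A (n + p) ↔ A n)) {L : Language Unit} (hL : ∀ w, w ∈ L ↔ A w.length) :
    L.IsRegular := by
  refine Language.IsRegular.of_finite_range_leftQuotient (((Finset.range (t + p)).finite_toSet.image
    fun i => ({w | A (i + w.length)} : Language Unit)).subset ?_)
  rintro _ ⟨w, rfl⟩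
  obtain ⟨h1, h2⟩ := exists_iterate_lassoNext hp hA w.length
  refine ⟨_, by simpa using h1, ?_⟩
  refine Language.ext fun z => ?_
  change A _ ↔ w ++ z ∈ L
  rw [hL, List.length_append, h2]

theorem primrec_lasso : Primrec fun x : (ℕ × ℕ) × List ℕ => lasso x.1.1 x.1.2 x.2 := by
  have hsum : Primrec fun x : (ℕ × ℕ) × List ℕ => x.1.1 + x.1.2 :=
    Primrec.nat_add.comp (Primrec.fst.comp Primrec.fst) (Primrec.snd.comp Primrec.fst)
  refine Primrec.pair (.const [0]) (Primrec.pair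
    (Primrec.list_map (Primrec.list_range.comp hsum) ?_) Primrec.snd)
  refine Primrec.pair Primrec.snd (Primrec.pair (.const ()) ?_)
  exact Primrec.ite (Primrec.eq.comp (Primrec.succ.comp Primrec.snd) (hsum.comp Primrec.fst))
    (Primrec.fst.comp (Primrec.fst.comp Primrec.fst)) (Primrec.succ.comp Primrec.snd)

/-! ## Representatives of a generated subalgebra -/

/-- The letter at position `j` shows which components are longer than `j`. -/
theorem tupleConv_injective {n : ℕ} : Function.Injective (tupleConv (n := n)) := by
  intro ns ms h
  have key : ∀ j i, j < ns i ↔ j < ms i := by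
    intro j i
    have hj := congrArg (fun l => l[j]?) h
    simp only [getElem?_tupleConv] at hj
    by_cases h1 : ∃ i, j < ns i <;> by_cases h2 : ∃ i, j < ms i
    · rw [if_pos h1, if_pos h2, Option.some.injEq] at hj
      have := congrFun (List.ofFn_injective hj) i
      by_contra hne
      by_cases h4 : j < ms i
      · simp [h4, show ¬ j < ns i from fun h3 => hne (iff_of_true h3 h4)] at this
      · simp [h4, show j < ns i from by_contra fun h3 => hne (iff_of_false h3 h4)] at this
    · simp [if_pos h1, if_neg h2] at hj
    · simp [if_neg h1, if_pos h2] at hj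
    · exact iff_of_false (fun h => h1 ⟨i, h⟩) fun h => h2 ⟨i, h⟩
  funext i
  exact eq_of_forall_lt_iff fun j => key j i

theorem conv_map_ofFn_eq_tupleConv {n : ℕ} (x : Fin n → List Unit) :
    (conv x).map List.ofFn = tupleConv fun i => (x i).length := by
  have : x = fun i => List.replicate (x i).length () :=
    funext fun i => List.eq_replicate_iff.2 ⟨rfl, fun _ _ => rfl⟩
  rw [tupleConv, ← this]

theorem replicate_length_unit (x : List Unit) : List.replicate x.length () = x :=
  (List.eq_replicate_iff.2 ⟨rfl, fun _ _ => rfl⟩).symm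

theorem FACode.RecognizesRel.tupleConv_mem_accepts_iff {n : ℕ} {c : FACode (List (Option Unit))}
    {R : Set (Fin n → List Unit)} (h : c.RecognizesRel R) (ns : Fin n → ℕ) :
    tupleConv ns ∈ c.accepts ↔ (fun i => List.replicate (ns i) ()) ∈ R := by
  rw [h]
  constructor
  · rintro ⟨x, hx, he⟩
    rw [conv_map_ofFn_eq_tupleConv] at he
    rw [tupleConv_injective he]
    simpa only [replicate_length_unit] using hx
  · exact fun hx => ⟨_, hx, rfl⟩

section

variable {σ : FirstOrder.Language.{u, v}} {S : Type w} [σ.Structure S] {φ : List Unit → S}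
  {P : PresentationCode}

open FirstOrder Language

/-- Each entry of `P` is a genuine operation, so a violation would contradict closure of `T`. The
converse, `substructureOfClosed`, needs instead that each operation has an entry. -/
theorem prefixWord_notMem_nonClosed (hP : P.Describes σ φ) (T : σ.Substructure S)
    {Y : ℕ → Bool} (hY : ∀ n, Y n = true ↔ φ (List.replicate n ()) ∈ T) (n : ℕ) :
    prefixWord Y n ∉ nonClosed P := by
  rintro ⟨e, he, ns, hns, hacc⟩
  obtain ⟨f, hf⟩ := hP.1 e he
  have hR := ((hf.tupleConv_mem_accepts_iff ns).1 hacc).2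
  have hlab : ∀ i, Y (ns i) = label i := by
    intro i
    have h1 := hns i
    have h2 := (List.getElem?_eq_some_iff.1 h1).1
    rw [getElem?_prefixWord Y (by simpa using h2)] at h1
    exact Option.some.inj h1
  have hval : φ (List.replicate (ns (Fin.last _)) ()) ∈ T := by
    have : Structure.funMap f (fun i : Fin e.1 => φ (List.replicate (ns i.castSucc) ())) =
      φ (List.replicate (ns (Fin.last _)) ()) := hR
    rw [← this]
    refine T.fun_mem f _ fun i => (hY _).1 ?_
    rw [hlab]
    simp [label, (Fin.castSucc_lt_last i).ne]
  have := (hY _).2 hval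
  rw [hlab] at this
  simp [label] at this

/-- The substructure of the elements represented by a set of words that is closed. -/
def substructureOfClosed [σ.IsAlgebraic] (hP : P.Describes σ φ) (hφ : Function.Surjective φ)
    (Y : ℕ → Bool) (hY : ∀ n, prefixWord Y n ∉ nonClosed P) : σ.Substructure S where
  carrier := {s | ∃ n, Y n = true ∧ φ (List.replicate n ()) = s}
  fun_mem := by
    intro k f s hs
    choose m hm hms using hs
    obtain ⟨x, hx⟩ := hφ (Structure.funMap f s)
    refine ⟨x.length, ?_, by rw [replicate_length_unit, hx]⟩
    by_contra hne
    obtain ⟨c, hc, hrec⟩ := hP.2 k f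
    let ns : Fin (k + 1) → ℕ := Fin.snoc (α := fun _ => ℕ) m x.length
    -- The prefix is just long enough to contain every component as a position.
    refine hY (Finset.univ.sup ns + 1) ⟨(k, c), hc, ns, fun i => ?_, ?_⟩
    · rw [getElem?_prefixWord Y (Nat.lt_succ_of_le (Finset.le_sup (Finset.mem_univ i)))]
      refine congrArg some ?_
      refine Fin.lastCases ?_ (fun i => ?_) i
      · simpa [ns, label] using hne
      · simpa [ns, label, (Fin.castSucc_lt_last i).ne] using hm i
    · refine (hrec.tupleConv_mem_accepts_iff ns).2 ⟨fun i => trivial, ?_⟩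
      change Structure.funMap f _ = _
      simp only [ns, Fin.snoc_castSucc, Fin.snoc_last, replicate_length_unit, hx]
      exact congrArg _ (funext hms)

/-- A number that exceeds the lengths of all words of `X`. -/
def lengthBound (X : List (List Unit)) : ℕ := X.flatten.length + 1

theorem lt_lengthBound {X : List (List Unit)} : ∀ n ∈ X.map List.length, n < lengthBound X := by
  intro n hn
  have := List.single_le_sum (by simp) n hn
  rw [lengthBound, List.length_flatten]
  omega

/-- A bound for the number of left quotients of `nonClosed P`. -/
def quotientBound (P : PresentationCode) : ℕ := 2 ^ (configs P).length

/-- The word of length `n` does not belong to any set of words that contains `X` and is closed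
under the relations of `P`, as decided by a search through words of bounded length. -/
def Omits (P : PresentationCode) (X : List (List Unit)) (n : ℕ) : Prop :=
  Avoidable (nonClosed P) (X.map List.length) (lengthBound X + quotientBound P) n

theorem omits_iff [σ.IsAlgebraic] (hφ : Function.Bijective φ) (hP : P.Describes σ φ)
    (X : List (List Unit)) (x : List Unit) :
    Omits P X x.length ↔ φ x ∉ Substructure.closure σ (φ '' {x | x ∈ X}) := by
  classical
  constructor
  · rintro ⟨y, hl, hB, hm, hn⟩
    -- The infinite word must keep the letter at `x.length` and all marks. The lookahead suffices
    -- because the sum of the two positive numbers in the maximum exceeds the maximum.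
    obtain ⟨Y, hYy, hY⟩ := exists_infinite_extension (a := max (x.length + 1) (lengthBound X))
      (fun _ y hx => append_mem_nonClosed y hx) (finite_range_leftQuotient_nonClosed P)
      (ncard_range_leftQuotient_nonClosed_le P) hB
      (by change _ + quotientBound P < _; rw [hl]; simp only [lengthBound]; omega)
    intro hx
    have hle : Substructure.closure σ (φ '' {x | x ∈ X}) ≤
        substructureOfClosed hP hφ.2 Y hY := by
      rw [Substructure.closure_le]
      rintro _ ⟨z, hz, rfl⟩
      refine ⟨z.length, ?_, by rw [replicate_length_unit]⟩
      have h1 : z.length ∈ X.map List.length := List.mem_map_of_mem hz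
      have h2 := lt_lengthBound _ h1
      have h3 := hm _ h1 (by omega)
      rw [hYy _ (by omega)] at h3
      exact Option.some.inj h3
    obtain ⟨n, hn1, hn2⟩ := hle hx
    obtain rfl := hφ.1 hn2
    rw [hYy _ (by omega), List.length_replicate, hn1] at hn
    simp at hn
  · intro hx
    set T := Substructure.closure σ (φ '' {x | x ∈ X}) with hT
    -- Conversely, the characteristic sequence of the closure supplies avoiding words of every
    -- length.
    let Y : ℕ → Bool := fun n => decide (φ (List.replicate n ()) ∈ T)
    refine ⟨prefixWord Y _, length_prefixWord _ _,
      prefixWord_notMem_nonClosed hP T (by simp [Y]) _, fun n hn hlt => ?_, ?_⟩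
    · rw [getElem?_prefixWord Y (by simpa using hlt)]
      obtain ⟨z, hz, rfl⟩ := List.mem_map.1 hn
      simp only [Y, replicate_length_unit, Option.some.injEq, decide_eq_true_eq]
      exact Substructure.subset_closure ⟨z, hz, rfl⟩
    · rw [getElem?_prefixWord Y (by omega)]
      simpa [Y, replicate_length_unit] using hx

/-- The threshold from which on `Omits P X` is periodic. -/
def threshold (P : PresentationCode) (X : List (List Unit)) : ℕ :=
  lengthBound X + 2 ^ quotientBound P

/-- A period of `Omits P X`. -/
def period (P : PresentationCode) : ℕ := (2 ^ quotientBound P).factorial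

theorem not_omits_add_period (P : PresentationCode) (X : List (List Unit)) (n : ℕ)
    (hn : threshold P X ≤ n) : ¬ Omits P X (n + period P) ↔ ¬ Omits P X n :=
  not_congr (avoidable_add_factorial (finite_range_leftQuotient_nonClosed P)
    (ncard_range_leftQuotient_nonClosed_le P) _ lt_lengthBound hn)

theorem mem_representatives_closure_iff [σ.IsAlgebraic] (hφ : Function.Bijective φ)
    (hP : P.Describes σ φ) (X : List (List Unit)) (x : List Unit) :
    x ∈ representatives φ (Substructure.closure σ (φ '' {x | x ∈ X}) : Set S) ↔
      ¬ Omits P X x.length := by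
  rw [omits_iff hφ hP, not_not]
  rfl

theorem IsInjectiveUnaryFAPresentation.bijective
    (h : IsInjectiveUnaryFAPresentation σ φ) : Function.Bijective φ :=
  ⟨h.2, fun s => (h.1.surjective s).imp fun _ hx => hx.2⟩

end

/-! ## The construction -/

open Classical in
/-- An automaton for the representatives of the subalgebra generated by `X`. -/
noncomputable def subalgebraCode (x : PresentationCode × List (List Unit)) : FACode Unit :=
  lasso (threshold x.1 x.2) (period x.1)
    ((List.range (threshold x.1 x.2 + period x.1)).filterMap fun n =>
      if Omits x.1 x.2 n then none else some n)

theorem mem_accepts_subalgebraCode (P : PresentationCode) (X : List (List Unit)) (w : List Unit) :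
    w ∈ (subalgebraCode (P, X)).accepts ↔ ¬ Omits P X w.length := by
  refine mem_accepts_lasso (A := fun n => ¬ Omits P X n) (Nat.factorial_pos _)
    (not_omits_add_period P X) (fun i hi => ?_) w
  simp only [List.mem_filterMap, List.mem_range]
  constructor
  · rintro ⟨n, -, h⟩
    split_ifs at h with hn
    obtain rfl := Option.some.inj h
    exact hn
  · exact fun h => ⟨i, hi, if_neg h⟩

theorem primrec_quotientBound : Primrec quotientBound :=
  primrec_two_pow.comp (Primrec.list_length.comp primrec_configs)

theorem primrec_lengthBound : Primrec lengthBound :=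
  Primrec.succ.comp (Primrec.list_length.comp Primrec.list_flatten)

theorem primrec_threshold : Primrec₂ threshold :=
  Primrec.nat_add.comp (primrec_lengthBound.comp Primrec.snd)
    (primrec_two_pow.comp (primrec_quotientBound.comp Primrec.fst))

theorem primrec_period : Primrec period :=
  primrec_factorial.comp (primrec_two_pow.comp primrec_quotientBound)

theorem primrecRel_omits :
    PrimrecRel fun (x : PresentationCode × List (List Unit)) (n : ℕ) => Omits x.1 x.2 n :=
  primrecPred_avoidable.comp (f := fun p : (PresentationCode × List (List Unit)) × ℕ =>
      ((p.1.1, p.1.2.map List.length), lengthBound p.1.2 + quotientBound p.1.1, p.2))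
    (.pair (.pair (Primrec.fst.comp Primrec.fst)
      (Primrec.list_map (Primrec.snd.comp Primrec.fst) (Primrec.list_length.comp Primrec.snd).to₂))
      (.pair (Primrec.nat_add.comp (primrec_lengthBound.comp (Primrec.snd.comp Primrec.fst))
        (primrec_quotientBound.comp (Primrec.fst.comp Primrec.fst))) Primrec.snd))

/-- The classical choice in `subalgebraCode` only decides `Omits`, which is primitive recursive. -/
theorem primrec_subalgebraCode : Primrec subalgebraCode := by
  classical
  have ht : Primrec fun x : PresentationCode × List (List Unit) => threshold x.1 x.2 :=
    primrec_threshold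
  have hp : Primrec fun x : PresentationCode × List (List Unit) => period x.1 :=
    primrec_period.comp Primrec.fst
  refine primrec_lasso.comp (.pair (.pair ht hp) (Primrec.listFilterMap
    (Primrec.list_range.comp (Primrec.nat_add.comp ht hp)) ?_))
  exact Primrec.ite primrecRel_omits (.const none) (Primrec.option_some.comp Primrec.snd)

/-! ## Codes for regular relations -/

/-- Relabelling transitions along `f` may create nondeterminism when `f` is not injective, which
codes allow. -/
theorem exists_code_accepts_map {α β : Type} [Finite α] {L : Language α} (hL : L.IsRegular)
    (f : α → β) : ∃ c : FACode β, c.accepts = {y | ∃ x ∈ L, y = x.map f} := by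
  obtain ⟨τ, _, M, rfl⟩ := hL
  have := Fintype.ofFinite α
  let e : τ → ℕ := fun s => Fintype.equivFin τ s
  have he : Function.Injective e := fun s t h => by simpa [e, Fin.val_inj] using h
  classical
  let c : FACode β := ([e M.start],
    (Finset.univ : Finset (τ × α)).toList.map fun p => (e p.1, f p.2, e (M.step p.1 p.2)),
    (Finset.univ.filter (· ∈ M.accept)).toList.map e)
  have hstep : ∀ s b q, q ∈ c.toNFA.step (e s) b ↔ ∃ a, f a = b ∧ q = e (M.step s a) := by
    intro s b q
    constructor
    · intro h
      obtain ⟨⟨t, a⟩, -, h⟩ := List.mem_map.1 h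
      simp only [Prod.mk.injEq] at h
      obtain ⟨h1, h2, h3⟩ := h
      obtain rfl := he h1
      exact ⟨a, h2, h3.symm⟩
    · rintro ⟨a, rfl, rfl⟩
      exact List.mem_map.2 ⟨(s, a), by simp, rfl⟩
  have heval : ∀ y s q, q ∈ c.toNFA.evalFrom {e s} y ↔
      ∃ x : List α, y = x.map f ∧ q = e (M.evalFrom s x) := by
    intro y
    induction y with
    | nil => intro s q; simp
    | cons b y ih =>
      intro s q
      rw [NFA.evalFrom_cons, NFA.stepSet_singleton, NFA.mem_evalFrom_iff_exists]
      constructor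
      · rintro ⟨r, hr, hq⟩
        obtain ⟨a, rfl, rfl⟩ := (hstep _ _ _).1 hr
        obtain ⟨x, rfl, rfl⟩ := (ih _ _).1 hq
        exact ⟨a :: x, rfl, rfl⟩
      · rintro ⟨x, hx, rfl⟩
        obtain ⟨a, x, rfl, rfl, rfl⟩ := List.map_eq_cons_iff.1 hx.symm
        exact ⟨_, (hstep _ _ _).2 ⟨a, rfl, rfl⟩, (ih _ _).2 ⟨x, rfl, rfl⟩⟩
  have hstart : c.toNFA.start = {e M.start} := by ext; simp [c, FACode.toNFA]
  refine ⟨c, Language.ext fun y => ?_⟩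
  change (∃ q ∈ c.toNFA.accept, q ∈ c.toNFA.evalFrom c.toNFA.start y) ↔ _
  rw [hstart]
  constructor
  · rintro ⟨q, hq, hqy⟩
    obtain ⟨x, rfl, rfl⟩ := (heval _ _ _).1 hqy
    obtain ⟨s, hs, hse⟩ := List.mem_map.1 hq
    obtain rfl := he hse
    exact ⟨x, (Finset.mem_filter.1 (Finset.mem_toList.1 hs)).2, rfl⟩
  · rintro ⟨x, hx, rfl⟩
    exact ⟨_, List.mem_map.2
      ⟨_, Finset.mem_toList.2 (Finset.mem_filter.2 ⟨Finset.mem_univ _, hx⟩), rfl⟩,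
      (heval _ _ _).2 ⟨x, rfl, rfl⟩⟩

theorem IsRegularRel.exists_recognizesRel {n : ℕ} {R : Set (Fin n → List Unit)}
    (h : IsRegularRel R) : ∃ c : FACode (List (Option Unit)), c.RecognizesRel R := by
  obtain ⟨c, hc⟩ := exists_code_accepts_map h List.ofFn
  refine ⟨c, hc.trans (Set.ext fun y => ?_)⟩
  constructor
  · rintro ⟨_, ⟨x, hx, rfl⟩, rfl⟩
    exact ⟨x, hx, rfl⟩
  · rintro ⟨x, hx, rfl⟩
    exact ⟨_, ⟨x, hx, rfl⟩, rfl⟩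

theorem IsFAPresentation.exists_describes {σ : FirstOrder.Language.{u, v}}
    [Finite (Σ k, σ.Functions k)] {S : Type w} [σ.Structure S] {φ : List Unit → S}
    (h : IsFAPresentation σ (⊤ : Language Unit) φ) :
    ∃ P : PresentationCode, P.Describes σ φ := by
  have := Fintype.ofFinite (Σ k, σ.Functions k)
  choose c hc using fun k f => (h.fun_regular k f).exists_recognizesRel
  refine ⟨(Finset.univ : Finset (Σ k, σ.Functions k)).toList.map fun f => (f.1, c f.1 f.2), ?_, ?_⟩
  · intro e he
    obtain ⟨f, -, rfl⟩ := List.mem_map.1 he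
    exact ⟨f.2, hc _ _⟩
  · exact fun k f => ⟨c k f, List.mem_map.2 ⟨⟨k, f⟩, by simp, rfl⟩, hc k f⟩

end FAPres

/-! ### The main theorem -/

theorem mainTheorem1 :
    -- regularity
    (∀ (σ : FirstOrder.Language.{u, v}) [σ.IsAlgebraic] [Finite (Σ k, σ.Functions k)]
      (S : Type w) [σ.Structure S] (φ : List Unit → S),
      FAPres.IsInjectiveUnaryFAPresentation σ φ →
      ∀ T : σ.Substructure S, T.FG →
        (FAPres.representatives φ (T : Set S)).IsRegular) ∧
    -- effective construction, by one algorithm for all presentations and all finite lists of words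
    (∃ construct : FAPres.PresentationCode × List (List Unit) →. FAPres.FACode Unit,
      Partrec construct ∧
      ∀ (σ : FirstOrder.Language.{u, v}) [σ.IsAlgebraic] [Finite (Σ k, σ.Functions k)]
        (S : Type w) [σ.Structure S] (φ : List Unit → S),
        FAPres.IsInjectiveUnaryFAPresentation σ φ →
        ∀ P : FAPres.PresentationCode, P.Describes σ φ →
        ∀ (X : List (List Unit)) (T : σ.Substructure S),
          FirstOrder.Language.Substructure.closure σ (φ '' {x | x ∈ X}) = T →
          ∃ c ∈ construct (P, X),
            c.accepts = FAPres.representatives φ (T : Set S)) := by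
  refine ⟨?_, FAPres.subalgebraCode, FAPres.primrec_subalgebraCode.to_comp, ?_⟩
  · rintro σ _ _ S _ φ hφ T ⟨s, rfl⟩
    obtain ⟨P, hP⟩ := hφ.1.exists_describes
    -- Surjectivity of `φ` turns the finite generating set into a list of words.
    obtain ⟨X, hX⟩ : ∃ X : List (List Unit), φ '' {x | x ∈ X} = s := by
      refine ⟨s.toList.map (Function.surjInv hφ.bijective.2), ?_⟩
      ext a
      simp [Function.surjInv_eq]
    rw [← hX]
    exact FAPres.isRegular_of_eventually_periodic (A := fun n => ¬ FAPres.Omits P X n)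
      (Nat.factorial_pos _) (FAPres.not_omits_add_period P X)
      (FAPres.mem_representatives_closure_iff hφ.bijective hP X)
  · rintro σ _ _ S _ φ hφ P hP X _ rfl
    refine ⟨_, Part.mem_some _, Language.ext fun w => ?_⟩
    rw [FAPres.mem_accepts_subalgebraCode,
      FAPres.mem_representatives_closure_iff hφ.bijective hP X]
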